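/- Let $\mathbb E$ be an arbitrary (not necessarily separable) real Banach space, and let $\mathfrak C(\mathbb E)$ be the set of nonempty closed bounded subsets of $\mathbb E$ and $\mathfrak C_c(\mathbb E)\subset\mathfrak C(\mathbb E)$ the set of those that are convex, both equipped with the Pompeiu–Hausdorff metric $h$ and its Borel $\sigma$-algebra. For $A\in\mathfrak C(\mathbb E)$ put $\|A\|=\sup_{x\in A}\|x\|$. Let $(\Omega,\mathscr A,P)$ be a complete probability space without atoms (every $A\in\mathscr A$ with $P(A)>0$ contains some $B\in\mathscr A$ with $0<P(B)<P(A)$). A map from $\Omega$ to a metric space $(M,d)$ is countably-valued if it is constant on each piece of a countable measurable partition of $\Omega$. A map $F:\Omega\to M$ is strongly measurable if there are countably-valued maps $G_n:\Omega\to M$ with $\operatorname{ess\,sup}_{\omega}d(G_n(\omega),F(\omega))\to0$. A random set is a strongly measurable map $F:\Omega\to\mathfrak C(\mathbb E)$ with $\int_\Omega\|F\|\,dP<\infty$. Its expectation is $$E(F)=\overline{\Big\{\int_\Omega f\,dP \;:\; f:\Omega\to\mathbb E \text{ strongly measurable},\ f(\omega)\in F(\omega)\text{ for all }\omega\in\Omega\Big\}},$$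 with Bochner integrals. **Theorem.** Let $\mathcal U$ be a nonempty separable subset of $\mathfrak C(\mathbb E)$. Let $(X_n)_{n\ge1}$ be a sequence of independent identically distributed random sets $X_n:\Omega\to\mathcal U$ with expectation $E(X_n)=C$ for all $n$, where $C\in\mathfrak C_c(\mathbb E)$. Then, for $P$-almost every $\omega\in\Omega$, $$h\left(\frac{\overline{\overline{\mathrm{co}}\,X_1(\omega)+\dots+\overline{\mathrm{co}}\,X_n(\omega)}}{n},\;C\right)\longrightarrow 0\qquad\text{as } n\to\infty,$$ where $\overline{\mathrm{co}}$ denotes the closed convex hull and the sum is the Minkowski sum. -/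

import Mathlib

open MeasureTheory ProbabilityTheory Filter Topology
open scoped Pointwise ENNReal

/-- The space `𝔆(E)` of nonempty closed bounded subsets of `E`. -/
structure ClosedBoundedSet (E : Type*) [NormedAddCommGroup E] where
  carrier : Set E
  nonempty' : carrier.Nonempty
  isClosed' : IsClosed carrier
  isBounded' : Bornology.IsBounded carrier

namespace ClosedBoundedSet

variable {E : Type*} [NormedAddCommGroup E]

instance : SetLike (ClosedBoundedSet E) E where
  coe := ClosedBoundedSet.carrier
  coe_injective := by
    rintro ⟨s, _, _, _⟩ ⟨t, _, _, _⟩ h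
    cases h
    rfl

/-- A member of `𝔆(E)` viewed in Mathlib's space of closed sets. -/
def toCloseds (A : ClosedBoundedSet E) : TopologicalSpace.Closeds E := ⟨A, A.isClosed'⟩

theorem toCloseds_injective : Function.Injective (toCloseds (E := E)) := by
  intro A B h
  exact SetLike.coe_injective (congrArg (fun Z : TopologicalSpace.Closeds E => (Z : Set E)) h)

noncomputable instance : EMetricSpace (ClosedBoundedSet E) :=
  EMetricSpace.induced toCloseds toCloseds_injective inferInstance

theorem edist_eq (A B : ClosedBoundedSet E) :
    edist A B = Metric.hausdorffEDist (A : Set E) (B : Set E) := rfl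

/-- `𝔆(E)` with the Pompeiu-Hausdorff metric. -/
noncomputable instance : MetricSpace (ClosedBoundedSet E) :=
  EMetricSpace.toMetricSpace fun A B =>
    Metric.hausdorffEDist_ne_top_of_nonempty_of_bounded A.nonempty' B.nonempty'
      A.isBounded' B.isBounded'

theorem dist_eq (A B : ClosedBoundedSet E) :
    dist A B = Metric.hausdorffDist (A : Set E) (B : Set E) := rfl

/-- `𝔆(E)` carries the Borel σ-algebra of the Pompeiu-Hausdorff metric. -/
noncomputable instance : MeasurableSpace (ClosedBoundedSet E) := borel _

instance : BorelSpace (ClosedBoundedSet E) := ⟨rfl⟩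

/-- `‖A‖ = sup {‖x‖ : x ∈ A}`. -/
noncomputable def supNorm (A : ClosedBoundedSet E) : ℝ :=
  sSup ((fun x : E => ‖x‖) '' (A : Set E))

end ClosedBoundedSet

/-- `G` is countably-valued: it is constant on each piece of a countable measurable partition
of `Ω` (pieces may be empty, so finite partitions are included). -/
def IsCountablyValued {Ω M : Type*} [MeasurableSpace Ω] (G : Ω → M) : Prop :=
  ∃ (A : ℕ → M) (S : ℕ → Set Ω),
    (∀ i, MeasurableSet (S i)) ∧ Pairwise (fun i j => Disjoint (S i) (S j)) ∧
      (⋃ i, S i) = Set.univ ∧ ∀ i, ∀ ω ∈ S i, G ω = A i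

/-- `F` is the limit, uniformly almost surely, of countably-valued maps. For `M = 𝔆(E)` this is
strong measurability of a set-valued map; for `M = E` it is (Bochner) measurability. -/
def IsUniformLimitOfCountablyValued {Ω M : Type*} [MeasurableSpace Ω] [PseudoEMetricSpace M]
    (μ : Measure Ω) (F : Ω → M) : Prop :=
  ∃ G : ℕ → Ω → M, (∀ n, IsCountablyValued (G n)) ∧
    Tendsto (fun n => essSup (fun ω => edist (G n ω) (F ω)) μ) atTop (𝓝 0)

/-- Random sets: strongly measurable maps `F : Ω → 𝔆(E)` with `∫ ‖F‖ dμ < ∞`. -/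
structure IsRandomSet {Ω E : Type*} [MeasurableSpace Ω] [NormedAddCommGroup E]
    (μ : Measure Ω) (F : Ω → ClosedBoundedSet E) : Prop where
  stronglyMeasurable : IsUniformLimitOfCountablyValued μ F
  integrable_supNorm : Integrable (fun ω => (F ω).supNorm) μ

/-- The measurable selectors of `F`. -/
def measurableSelectors {Ω E : Type*} [MeasurableSpace Ω] [NormedAddCommGroup E]
    (μ : Measure Ω) (F : Ω → ClosedBoundedSet E) : Set (Ω → E) :=
  {f | IsUniformLimitOfCountablyValued μ f ∧ ∀ ω, f ω ∈ F ω}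

/-- The expectation of a random set: its Aumann integral, the closure of the set of Bochner
integrals of its measurable selectors. -/
noncomputable def setExpectation {Ω E : Type*} [MeasurableSpace Ω] [NormedAddCommGroup E]
    [NormedSpace ℝ E] (μ : Measure Ω) (F : Ω → ClosedBoundedSet E) : Set E :=
  closure ((fun f : Ω → E => ∫ ω, f ω ∂μ) '' measurableSelectors μ F)

/-- `μ` has no atoms: each measurable set of positive measure contains a measurable subset of
strictly smaller positive measure. -/
def HasNoAtoms {Ω : Type*} [MeasurableSpace Ω] (μ : Measure Ω) : Prop :=
  ∀ A : Set Ω, MeasurableSet A → 0 < μ A →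
    ∃ B : Set Ω, B ⊆ A ∧ MeasurableSet B ∧ 0 < μ B ∧ μ B < μ A

/-! A set is encoded by its support function `φ ↦ sup φ(A)` on the dual unit ball, a point of the
Banach space of bounded continuous functions. The encoding is 1-Lipschitz, and it turns Minkowski
sums of closed convex hulls into sums, so the averages of sets become averages of i.i.d. Bochner
integrable vectors, to which the strong law applies. Two facts translate back. Near-optimal
measurable selectors show that the mean vector is the support function of `C`
(`integral_supportFunction_eq`). Hahn–Banach separation shows that for convex sets the Hausdorff
distance is at most the uniform distance of support functions (`infDist_le_of_support_le`). -/

section SupportFunction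

/-! ### Suprema of functionals and separation of convex sets. -/

variable {E : Type*} [NormedAddCommGroup E] [NormedSpace ℝ E]

/-- Reduces hulls and closures to one remark: the half-space `φ ≤ b` is closed and convex. -/
theorem isLUB_image_iff_of_upperBounds {A B : Set E} {φ : StrongDual ℝ E} {c : ℝ}
    (h : ∀ b, (∀ x ∈ A, φ x ≤ b) ↔ ∀ x ∈ B, φ x ≤ b) :
    IsLUB (φ '' A) c ↔ IsLUB (φ '' B) c := by
  have : upperBounds (φ '' A) = upperBounds (φ '' B) := by
    ext b
    simpa [upperBounds] using h b
  rw [IsLUB, IsLUB, this]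

theorem isLUB_image_closedConvexHull {A : Set E} {φ : StrongDual ℝ E} {c : ℝ} :
    IsLUB (φ '' closedConvexHull ℝ A) c ↔ IsLUB (φ '' A) c := by
  refine isLUB_image_iff_of_upperBounds fun b => ⟨fun h x hx => h x (subset_closedConvexHull hx),
    fun h x hx => ?_⟩
  have hconv : Convex ℝ {x : E | φ x ≤ b} := convex_halfSpace_le φ.toLinearMap.isLinear b
  have hclosed : IsClosed {x : E | φ x ≤ b} := isClosed_le φ.continuous continuous_const
  exact closedConvexHull_min (𝕜 := ℝ) (s := A) h hconv hclosed hx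

theorem isLUB_image_closure {A : Set E} {φ : StrongDual ℝ E} {c : ℝ} :
    IsLUB (φ '' closure A) c ↔ IsLUB (φ '' A) c := by
  refine isLUB_image_iff_of_upperBounds fun b => ⟨fun h x hx => h x (subset_closure hx),
    fun h x hx => ?_⟩
  have hclosed : IsClosed {x : E | φ x ≤ b} := isClosed_le φ.continuous continuous_const
  exact closure_minimal (s := A) h hclosed hx

theorem isLUB_image_smul {A : Set E} {φ : StrongDual ℝ E} {c t : ℝ} (ht : 0 < t)
    (h : IsLUB (φ '' A) c) : IsLUB (φ '' (t • A)) (t • c) := by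
  have : φ '' (t • A) = (fun y : ℝ => t * y) '' (φ '' A) := by
    ext y
    simp [Set.mem_smul_set]
  rw [this]
  exact (OrderIso.mulLeft₀ t ht).isLUB_image'.2 h

theorem isLUB_image_sum {ι : Type*} (s : Finset ι) {A : ι → Set E} {c : ι → ℝ}
    {φ : StrongDual ℝ E} (h : ∀ i ∈ s, IsLUB (φ '' A i) (c i)) :
    IsLUB (φ '' ∑ i ∈ s, A i) (∑ i ∈ s, c i) := by
  classical
  induction s using Finset.induction_on with
  | empty => simp [← Set.singleton_zero]
  | insert i s hi ih =>
    rw [Finset.sum_insert hi, Finset.sum_insert hi, Set.image_add]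
    exact (h i (by simp)).add (ih fun j hj => h j (by simp [hj]))

/-- If the support function of `A` exceeds that of the convex set `B` by at most `r` on the dual
unit ball, then `A` lies in the closed `r`-neighbourhood of `B`. -/
theorem infDist_le_of_support_le {A B : Set E} (hB : Convex ℝ B) (hBne : B.Nonempty)
    {a b : StrongDual ℝ E → ℝ} {r : ℝ} (hr : 0 ≤ r)
    (ha : ∀ φ : StrongDual ℝ E, ‖φ‖ ≤ 1 → IsLUB (φ '' A) (a φ))
    (hb : ∀ φ : StrongDual ℝ E, ‖φ‖ ≤ 1 → IsLUB (φ '' B) (b φ))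
    (hab : ∀ φ : StrongDual ℝ E, ‖φ‖ ≤ 1 → a φ ≤ b φ + r) {x : E} (hx : x ∈ A) :
    Metric.infDist x B ≤ r := by
  by_contra! hlt
  -- Two radii `r < ρ < ρ'`: the open `ρ'`-ball is separated from `B`, and the closed `ρ`-ball
  -- inside it bounds `‖f‖`.
  obtain ⟨ρ', hρ', hρx⟩ := exists_between hlt
  obtain ⟨ρ, hρ, hρρ⟩ := exists_between hρ'
  have hρ0 : 0 < ρ := hr.trans_lt hρ
  have hρ0' : 0 < ρ' := hρ0.trans hρρ
  have hdisj : Disjoint (Metric.ball x ρ') B := by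
    rw [Set.disjoint_left]
    intro y hy hyB
    have := Metric.infDist_le_dist_of_mem (x := x) hyB
    rw [Metric.mem_ball, dist_comm] at hy
    linarith
  obtain ⟨f, u, hfu, huf⟩ :=
    geometric_hahn_banach_open (convex_ball x ρ') Metric.isOpen_ball hB hdisj
  have hf0 : 0 < ‖f‖ := by
    rw [norm_pos_iff]
    rintro rfl
    obtain ⟨y, hy⟩ := hBne
    have h1 := hfu x (Metric.mem_ball_self hρ0')
    have h2 := huf y hy
    simp at h1 h2
    linarith
  have hnorm : ‖f‖ ≤ (u - f x) / ρ := by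
    refine ContinuousLinearMap.opNorm_bound_of_ball_bound hρ0 _ f fun z hz => ?_
    rw [mem_closedBall_zero_iff] at hz
    have h1 := hfu (x + z) (by simpa using hz.trans_lt hρρ)
    have h2 := hfu (x - z) (by simpa using hz.trans_lt hρρ)
    rw [map_add] at h1
    rw [map_sub] at h2
    exact abs_le.2 ⟨by linarith, by linarith⟩
  have hnorm' : ‖f‖ * ρ ≤ u - f x := (le_div_iff₀ hρ0).1 hnorm
  -- The sign is reversed because `f` is smaller on the ball than on `B`. Then `φ x` exceeds `φ` on
  -- `B` by at least `ρ > r`.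
  set φ : StrongDual ℝ E := -(‖f‖⁻¹ • f) with hφ
  have hφ1 : ‖φ‖ ≤ 1 := by
    rw [hφ, norm_neg, norm_smul, norm_inv, norm_norm, inv_mul_cancel₀ hf0.ne']
  have h1 : φ x ≤ a φ := (ha φ hφ1).1 ⟨x, hx, rfl⟩
  have h2 : b φ ≤ φ x - ρ := by
    refine (hb φ hφ1).2 ?_
    rintro _ ⟨y, hy, rfl⟩
    have h3 : ‖f‖ * ρ ≤ f y - f x := hnorm'.trans (by linarith [huf y hy])
    have h4 : ρ ≤ ‖f‖⁻¹ * (f y - f x) := by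
      rw [← div_eq_inv_mul, le_div_iff₀ hf0]
      linarith
    simp only [hφ, neg_apply, smul_apply, smul_eq_mul]
    linarith
  linarith [hab φ hφ1]

end SupportFunction

/-! ### The embedding by support functions. -/

namespace ClosedBoundedSet

variable {E : Type*} [NormedAddCommGroup E]

theorem norm_le_supNorm (A : ClosedBoundedSet E) {x : E} (hx : x ∈ A) : ‖x‖ ≤ A.supNorm := by
  obtain ⟨R, hR⟩ := A.isBounded'.exists_norm_le
  refine le_csSup ⟨R, ?_⟩ ⟨x, hx, rfl⟩
  rintro _ ⟨y, hy, rfl⟩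
  exact hR y hy

theorem supNorm_nonneg (A : ClosedBoundedSet E) : 0 ≤ A.supNorm := by
  obtain ⟨x, hx⟩ := A.nonempty'
  exact (norm_nonneg x).trans (A.norm_le_supNorm hx)

theorem hausdorffEDist_ne_top (A B : ClosedBoundedSet E) :
    Metric.hausdorffEDist (A : Set E) (B : Set E) ≠ ⊤ :=
  Metric.hausdorffEDist_ne_top_of_nonempty_of_bounded A.nonempty' B.nonempty'
    A.isBounded' B.isBounded'

theorem infDist_le_dist (A B : ClosedBoundedSet E) {x : E} (hx : x ∈ A) :
    Metric.infDist x (B : Set E) ≤ dist A B :=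
  Metric.infDist_le_hausdorffDist_of_mem hx (hausdorffEDist_ne_top A B)

theorem exists_mem_dist_lt (A : ClosedBoundedSet E) (x : E) {δ : ℝ} (hδ : 0 < δ) :
    ∃ y ∈ A, dist x y < Metric.infDist x (A : Set E) + δ :=
  (Metric.infDist_lt_iff A.nonempty').1 (lt_add_of_pos_right _ hδ)

variable [NormedSpace ℝ E]

/-- The support function of a closed bounded set, at a single functional. -/
noncomputable def support (A : ClosedBoundedSet E) (φ : StrongDual ℝ E) : ℝ :=
  sSup (φ '' (A : Set E))

theorem apply_le_norm_mul_supNorm (A : ClosedBoundedSet E) (φ : StrongDual ℝ E) {x : E}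
    (hx : x ∈ A) : φ x ≤ ‖φ‖ * A.supNorm :=
  (le_abs_self _).trans <| (φ.le_opNorm x).trans <|
    mul_le_mul_of_nonneg_left (A.norm_le_supNorm hx) (norm_nonneg _)

theorem isLUB_support (A : ClosedBoundedSet E) (φ : StrongDual ℝ E) :
    IsLUB (φ '' (A : Set E)) (A.support φ) := by
  refine isLUB_csSup (A.nonempty'.image φ) ⟨‖φ‖ * A.supNorm, ?_⟩
  rintro _ ⟨x, hx, rfl⟩
  exact A.apply_le_norm_mul_supNorm φ hx

theorem apply_le_support (A : ClosedBoundedSet E) (φ : StrongDual ℝ E) {x : E} (hx : x ∈ A) :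
    φ x ≤ A.support φ :=
  (A.isLUB_support φ).1 ⟨x, hx, rfl⟩

theorem support_le (A : ClosedBoundedSet E) {φ : StrongDual ℝ E} {b : ℝ}
    (h : ∀ x ∈ A, φ x ≤ b) : A.support φ ≤ b := by
  refine (A.isLUB_support φ).2 ?_
  rintro _ ⟨x, hx, rfl⟩
  exact h x hx

theorem exists_support_sub_lt (A : ClosedBoundedSet E) (φ : StrongDual ℝ E) {δ : ℝ} (hδ : 0 < δ) :
    ∃ x ∈ A, A.support φ - δ < φ x := by
  by_contra! h
  linarith [A.support_le h]

theorem abs_support_le (A : ClosedBoundedSet E) (φ : StrongDual ℝ E) :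
    |A.support φ| ≤ ‖φ‖ * A.supNorm := by
  refine abs_le.2 ⟨?_, A.support_le fun x hx => A.apply_le_norm_mul_supNorm φ hx⟩
  obtain ⟨x, hx⟩ := A.nonempty'
  have h' : -φ x ≤ ‖φ‖ * A.supNorm := by
    simpa using A.apply_le_norm_mul_supNorm (-φ) hx
  linarith [A.apply_le_support φ hx]

theorem support_le_support_add_dual (A : ClosedBoundedSet E) (φ ψ : StrongDual ℝ E) :
    A.support φ ≤ A.support ψ + A.supNorm * dist φ ψ := by
  refine A.support_le fun x hx => ?_
  have h1 := A.apply_le_norm_mul_supNorm (φ - ψ) hx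
  have h2 := A.apply_le_support ψ hx
  rw [sub_apply] at h1
  rw [dist_eq_norm]
  linarith

theorem support_le_support_add_dist (A B : ClosedBoundedSet E) {φ : StrongDual ℝ E}
    (hφ : ‖φ‖ ≤ 1) : A.support φ ≤ B.support φ + dist A B := by
  refine le_of_forall_pos_le_add fun δ hδ => A.support_le fun x hx => ?_
  obtain ⟨y, hy, hxy⟩ := B.exists_mem_dist_lt x hδ
  have h1 : φ (x - y) ≤ dist x y := by
    rw [dist_eq_norm]
    exact (le_abs_self _).trans ((φ.le_opNorm _).trans
      (mul_le_of_le_one_left (norm_nonneg _) hφ))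
  rw [map_sub] at h1
  linarith [B.apply_le_support φ hy, A.infDist_le_dist B hx]

theorem abs_support_sub_support_le (A B : ClosedBoundedSet E) {φ : StrongDual ℝ E}
    (hφ : ‖φ‖ ≤ 1) : |A.support φ - B.support φ| ≤ dist A B := by
  have h1 := A.support_le_support_add_dist B hφ
  have h2 := B.support_le_support_add_dist A hφ
  rw [dist_comm] at h2
  exact abs_le.2 ⟨by linarith, by linarith⟩

/-- The support function as a bounded continuous function on the unit ball of the dual. -/
noncomputable def supportFunction (A : ClosedBoundedSet E) :
    BoundedContinuousFunction (Metric.closedBall (0 : StrongDual ℝ E) 1) ℝ :=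
  BoundedContinuousFunction.ofNormedAddCommGroup (fun φ => A.support φ)
    ((LipschitzWith.of_le_add_mul ⟨A.supNorm, A.supNorm_nonneg⟩ fun φ ψ =>
      A.support_le_support_add_dual φ ψ).continuous.comp continuous_subtype_val) A.supNorm fun φ => by
        refine (A.abs_support_le φ).trans (mul_le_of_le_one_left A.supNorm_nonneg ?_)
        exact mem_closedBall_zero_iff.1 φ.2

@[simp]
theorem supportFunction_apply (A : ClosedBoundedSet E)
    (φ : Metric.closedBall (0 : StrongDual ℝ E) 1) : A.supportFunction φ = A.support φ := rfl

theorem norm_supportFunction_le (A : ClosedBoundedSet E) : ‖A.supportFunction‖ ≤ A.supNorm :=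
  BoundedContinuousFunction.norm_ofNormedAddCommGroup_le _ A.supNorm_nonneg _

/-- Functionals of norm at most 1 are 1-Lipschitz. This carries measurability, hence independence
and equality of laws, from sets to vectors. -/
theorem lipschitzWith_supportFunction :
    LipschitzWith 1 (supportFunction : ClosedBoundedSet E → _) :=
  LipschitzWith.of_dist_le_mul fun A B => by
    rw [NNReal.coe_one, one_mul, BoundedContinuousFunction.dist_le dist_nonneg]
    intro φ
    exact A.abs_support_sub_support_le B (mem_closedBall_zero_iff.1 φ.2)

end ClosedBoundedSet

/-! ### Countably-valued maps and their uniform limits. -/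

namespace IsCountablyValued

variable {Ω M N : Type*} [MeasurableSpace Ω]

/-- Since `g` is arbitrary, points may be picked from sets by choice functions without losing
measurability. -/
theorem comp {G : Ω → M} (hG : IsCountablyValued G) (g : M → N) :
    IsCountablyValued fun ω => g (G ω) := by
  obtain ⟨A, S, hS, hd, hU, h⟩ := hG
  exact ⟨fun i => g (A i), S, hS, hd, hU, fun i ω hω => congrArg g (h i ω hω)⟩

theorem prodMk {G : Ω → M} {H : Ω → N} (hG : IsCountablyValued G) (hH : IsCountablyValued H) :
    IsCountablyValued fun ω => (G ω, H ω) := by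
  obtain ⟨A, S, hS, hdS, hUS, hGA⟩ := hG
  obtain ⟨B, T, hT, hdT, hUT, hHB⟩ := hH
  refine ⟨fun k => (A k.unpair.1, B k.unpair.2), fun k => S k.unpair.1 ∩ T k.unpair.2,
    fun k => (hS _).inter (hT _), fun k l hkl => ?_, ?_, fun k ω hω => ?_⟩
  · refine Set.disjoint_left.2 ?_
    rintro ω ⟨h1, h2⟩ ⟨h3, h4⟩
    have e1 : k.unpair.1 = l.unpair.1 := by
      by_contra hne
      exact Set.disjoint_left.1 (hdS hne) h1 h3
    have e2 : k.unpair.2 = l.unpair.2 := by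
      by_contra hne
      exact Set.disjoint_left.1 (hdT hne) h2 h4
    exact hkl (by rw [← Nat.pair_unpair k, ← Nat.pair_unpair l, e1, e2])
  · refine Set.eq_univ_of_forall fun ω => ?_
    obtain ⟨i, hi⟩ := Set.mem_iUnion.1 (hUS.ge (Set.mem_univ ω))
    obtain ⟨j, hj⟩ := Set.mem_iUnion.1 (hUT.ge (Set.mem_univ ω))
    exact Set.mem_iUnion.2 ⟨Nat.pair i j, by simpa using ⟨hi, hj⟩⟩
  · simp only [hGA _ ω hω.1, hHB _ ω hω.2]

theorem countable_range {G : Ω → M} (hG : IsCountablyValued G) : (Set.range G).Countable := by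
  obtain ⟨A, S, -, -, hU, h⟩ := hG
  refine (Set.countable_range A).mono ?_
  rintro _ ⟨ω, rfl⟩
  obtain ⟨i, hi⟩ := Set.mem_iUnion.1 (hU.ge (Set.mem_univ ω))
  exact ⟨i, (h i ω hi).symm⟩

theorem measurableSet_preimage {G : Ω → M} (hG : IsCountablyValued G) (T : Set M) :
    MeasurableSet (G ⁻¹' T) := by
  obtain ⟨A, S, hS, -, hU, h⟩ := hG
  have : G ⁻¹' T = ⋃ i ∈ {i | A i ∈ T}, S i := by
    ext ω
    simp only [Set.mem_preimage, Set.mem_ofPred_eq, Set.mem_iUnion, exists_prop]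
    constructor
    · intro hω
      obtain ⟨i, hi⟩ := Set.mem_iUnion.1 (hU.ge (Set.mem_univ ω))
      exact ⟨i, h i ω hi ▸ hω, hi⟩
    · rintro ⟨i, hi, hω⟩
      rwa [h i ω hω]
  rw [this]
  exact MeasurableSet.biUnion (Set.to_countable _) fun i _ => hS i

theorem stronglyMeasurable [PseudoEMetricSpace M] {G : Ω → M} (hG : IsCountablyValued G) :
    StronglyMeasurable G := by
  borelize M
  exact stronglyMeasurable_iff_measurable_separable.2
    ⟨fun T _ => hG.measurableSet_preimage T, hG.countable_range.isSeparable⟩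

end IsCountablyValued

section UniformLimit

variable {Ω M : Type*} [MeasurableSpace Ω] {μ : Measure Ω}

theorem isUniformLimitOfCountablyValued_iff [PseudoMetricSpace M] {F : Ω → M} :
    IsUniformLimitOfCountablyValued μ F ↔
      ∀ δ : ℝ, 0 < δ → ∃ G : Ω → M, IsCountablyValued G ∧ ∀ᵐ ω ∂μ, dist (G ω) (F ω) ≤ δ := by
  constructor
  · rintro ⟨G, hG, hlim⟩ δ hδ
    obtain ⟨n, hn⟩ :=
      (hlim.eventually (gt_mem_nhds (ENNReal.ofReal_pos.2 hδ))).exists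
    refine ⟨G n, hG n, ?_⟩
    filter_upwards [ENNReal.ae_le_essSup fun ω => edist (G n ω) (F ω)] with ω hω
    exact (edist_le_ofReal hδ.le).1 (hω.trans hn.le)
  · intro h
    choose G hG hGF using fun n : ℕ => h (1 / ((n : ℝ) + 1)) Nat.one_div_pos_of_nat
    refine ⟨G, hG, ?_⟩
    have hz : Tendsto (fun n : ℕ => ENNReal.ofReal (1 / ((n : ℝ) + 1))) atTop (𝓝 0) := by
      simpa using ENNReal.tendsto_ofReal (tendsto_one_div_add_atTop_nhds_zero_nat (𝕜 := ℝ))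
    refine tendsto_of_tendsto_of_tendsto_of_le_of_le tendsto_const_nhds hz
      (fun _ => zero_le) fun n => essSup_le_of_ae_le _ ?_
    filter_upwards [hGF n] with ω hω
    exact (edist_le_ofReal Nat.one_div_pos_of_nat.le).2 hω

theorem IsUniformLimitOfCountablyValued.aestronglyMeasurable [PseudoMetricSpace M] {F : Ω → M}
    (hF : IsUniformLimitOfCountablyValued μ F) : AEStronglyMeasurable F μ := by
  choose G hG hGF using fun n : ℕ =>
    isUniformLimitOfCountablyValued_iff.1 hF (1 / ((n : ℝ) + 1)) Nat.one_div_pos_of_nat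
  refine aestronglyMeasurable_of_tendsto_ae atTop
    (fun n => (hG n).stronglyMeasurable.aestronglyMeasurable) ?_
  filter_upwards [ae_all_iff.2 hGF] with ω hω
  exact tendsto_iff_dist_tendsto_zero.2 (squeeze_zero (fun _ => dist_nonneg) hω
    tendsto_one_div_add_atTop_nhds_zero_nat)

end UniformLimit

/-! ### Measurable selectors and the expectation. -/

section Selectors

variable {Ω E : Type*} [MeasurableSpace Ω] {μ : Measure Ω} [NormedAddCommGroup E]

theorem integrable_of_mem_measurableSelectors {F : Ω → ClosedBoundedSet E}
    (hF : IsRandomSet μ F) {f : Ω → E} (hf : f ∈ measurableSelectors μ F) : Integrable f μ :=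
  hF.integrable_supNorm.mono' hf.1.aestronglyMeasurable
    (.of_forall fun ω => (F ω).norm_le_supNorm (hf.2 ω))

variable [NormedSpace ℝ E]

theorem integrable_supportFunction {F : Ω → ClosedBoundedSet E} (hF : IsRandomSet μ F) :
    Integrable (fun ω => (F ω).supportFunction) μ :=
  hF.integrable_supNorm.mono'
    (ClosedBoundedSet.lipschitzWith_supportFunction.continuous.comp_aestronglyMeasurable
      hF.stronglyMeasurable.aestronglyMeasurable)
    (.of_forall fun ω => (F ω).norm_supportFunction_le)

variable [CompleteSpace E]

/-- A strongly measurable set-valued map has measurable selectors that almost attain the support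
function at a given functional. -/
theorem exists_measurableSelector_support_sub_le {F : Ω → ClosedBoundedSet E}
    (hF : IsUniformLimitOfCountablyValued μ F) {φ : StrongDual ℝ E} (hφ : ‖φ‖ ≤ 1)
    {ε : ℝ} (hε : 0 < ε) :
    ∃ f ∈ measurableSelectors μ F, ∀ᵐ ω ∂μ, (F ω).support φ - ε ≤ φ (f ω) := by
  classical
  -- The losses are `δ` from replacing `F` by `G 0`, `δ` from `start`, and `6 * δ` from passing from
  -- `f 0` to the limit.
  set δ : ℝ := ε / 8 with hδ
  have hδ0 : 0 < δ := by positivity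
  have hd0 : ∀ n : ℕ, 0 < δ / 2 ^ n := fun n => by positivity
  choose G hG hGF using fun n : ℕ => isUniformLimitOfCountablyValued_iff.1 hF (δ / 2 ^ n) (hd0 n)
  choose start start_mem hstart using
    fun A : ClosedBoundedSet E => A.exists_support_sub_lt φ hδ0
  choose next next_mem hnext using
    fun (n : ℕ) (x : E) (A : ClosedBoundedSet E) => A.exists_mem_dist_lt x (hd0 n)
  -- Each `f (n + 1)` is an almost nearest point of `G (n + 1)` to `f n`. It depends only on
  -- countably-valued data, so it is countably-valued.
  let f : ℕ → Ω → E := fun n =>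
    Nat.rec (fun ω => start (G 0 ω)) (fun n fn ω => next n (fn ω) (G (n + 1) ω)) n
  have f_zero : ∀ ω, f 0 ω = start (G 0 ω) := fun _ => rfl
  have f_succ : ∀ n ω, f (n + 1) ω = next n (f n ω) (G (n + 1) ω) := fun _ _ => rfl
  have f_count : ∀ n, IsCountablyValued (f n) := by
    intro n
    induction n with
    | zero => exact (hG 0).comp start
    | succ n ih => exact (ih.prodMk (hG (n + 1))).comp fun p => next n p.1 p.2
  have f_mem : ∀ n ω, f n ω ∈ G n ω := by
    intro n ω
    cases n with
    | zero => exact start_mem _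
    | succ n => exact next_mem _ _ _
  have key : ∀ᵐ ω ∂μ, ∃ y ∈ F ω, (∀ n, dist (f n ω) y ≤ 6 * δ / 2 ^ n) ∧
      (F ω).support φ - ε ≤ φ y := by
    filter_upwards [ae_all_iff.2 hGF] with ω hω
    -- The step is at most `3 * δ / 2 ^ n`: at most `2 * δ / 2 ^ n` between the sets through `F ω`,
    -- plus the slack in `next`. The odd form is the one the geometric series lemma expects.
    have hstep : ∀ n, dist (f n ω) (f (n + 1) ω) ≤ 6 * δ / 2 / 2 ^ n := by
      intro n
      have h1 := (hnext n (f n ω) (G (n + 1) ω)).le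
      rw [← f_succ] at h1
      have h2 := (G n ω).infDist_le_dist (G (n + 1) ω) (f_mem n ω)
      have h3 := dist_triangle_right (G n ω) (G (n + 1) ω) (F ω)
      have h4 : δ / 2 ^ (n + 1) ≤ δ / 2 ^ n := by
        gcongr
        · norm_num
        · omega
      have h5 : 6 * δ / 2 / 2 ^ n = 3 * (δ / 2 ^ n) := by ring
      rw [h5]
      linarith [hω n, hω (n + 1)]
    obtain ⟨y, hy⟩ := cauchySeq_tendsto_of_complete (cauchySeq_of_le_geometric_two hstep)
    have hdist : ∀ n, dist (f n ω) y ≤ 6 * δ / 2 ^ n :=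
      dist_le_of_le_geometric_two_of_tendsto hstep hy
    have hyF : y ∈ F ω := by
      have hz : Tendsto (fun n : ℕ => 7 * δ / 2 ^ n) atTop (𝓝 0) := by
        have := (tendsto_pow_atTop_nhds_zero_of_lt_one (r := (1 / 2 : ℝ)) (by norm_num)
          (by norm_num)).const_mul (7 * δ)
        simpa [div_eq_mul_inv] using this
      have hle : Metric.infDist y (F ω : Set E) ≤ 0 := by
        refine ge_of_tendsto' hz fun n => ?_
        have h1 := (G n ω).infDist_le_dist (F ω) (f_mem n ω)
        have h2 := Metric.infDist_le_infDist_add_dist (s := (F ω : Set E)) (x := y) (y := f n ω)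
        rw [dist_comm] at h2
        have h3 : 7 * δ / 2 ^ n = δ / 2 ^ n + 6 * δ / 2 ^ n := by ring
        linarith [hω n, hdist n]
      exact ((F ω).isClosed'.mem_iff_infDist_zero (F ω).nonempty').2
        (le_antisymm hle Metric.infDist_nonneg)
    refine ⟨y, hyF, hdist, ?_⟩
    have h1 := (F ω).support_le_support_add_dist (G 0 ω) hφ
    have h2 := hstart (G 0 ω)
    rw [← f_zero] at h2
    have h3 : φ (f 0 ω - y) ≤ dist (f 0 ω) y := by
      rw [dist_eq_norm]
      exact (le_abs_self _).trans ((φ.le_opNorm _).trans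
        (mul_le_of_le_one_left (norm_nonneg _) hφ))
    rw [map_sub] at h3
    have h4 := hω 0
    have h5 := hdist 0
    rw [dist_comm] at h4
    simp only [pow_zero, div_one] at h4 h5
    linarith
  -- A selector must lie in `F ω` for every `ω`, but the limit is controlled only almost everywhere.
  -- On the exceptional null set any point of `F ω` serves, as uniform approximation ignores null
  -- sets.
  have ex : ∀ ω, ∃ y ∈ F ω, (∃ y ∈ F ω, (∀ n, dist (f n ω) y ≤ 6 * δ / 2 ^ n) ∧
      (F ω).support φ - ε ≤ φ y) → (∀ n, dist (f n ω) y ≤ 6 * δ / 2 ^ n) ∧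
      (F ω).support φ - ε ≤ φ y := by
    intro ω
    by_cases h : ∃ y ∈ F ω, (∀ n, dist (f n ω) y ≤ 6 * δ / 2 ^ n) ∧ (F ω).support φ - ε ≤ φ y
    · obtain ⟨y, hy, hy'⟩ := h
      exact ⟨y, hy, fun _ => hy'⟩
    · obtain ⟨y, hy⟩ := (F ω).nonempty'
      exact ⟨y, hy, fun h' => absurd h' h⟩
  choose g g_mem hg using ex
  refine ⟨g, ⟨isUniformLimitOfCountablyValued_iff.2 fun η hη => ?_, g_mem⟩,
    key.mono fun ω hω => (hg ω hω).2⟩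
  obtain ⟨n, hn⟩ := pow_unbounded_of_one_lt (6 * δ / η) (one_lt_two : (1 : ℝ) < 2)
  refine ⟨f n, f_count n, key.mono fun ω hω => ((hg ω hω).1 n).trans ?_⟩
  rw [div_le_iff₀ (by positivity)]
  rw [div_lt_iff₀ hη] at hn
  linarith

/-- The support function of the expectation is the expectation of the support function. -/
theorem integral_supportFunction_eq [IsProbabilityMeasure μ] {F : Ω → ClosedBoundedSet E}
    (hF : IsRandomSet μ F) {C : ClosedBoundedSet E} (hC : setExpectation μ F = (C : Set E)) :
    ∫ ω, (F ω).supportFunction ∂μ = C.supportFunction := by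
  ext φ
  have hφ : ‖(φ : StrongDual ℝ E)‖ ≤ 1 := mem_closedBall_zero_iff.1 φ.2
  have hint := integrable_supportFunction hF
  have hintφ : Integrable (fun ω => (F ω).support φ) μ :=
    (BoundedContinuousFunction.evalCLM ℝ φ).integrable_comp hint
  have heval : (∫ ω, (F ω).supportFunction ∂μ) φ = ∫ ω, (F ω).support φ ∂μ :=
    ((BoundedContinuousFunction.evalCLM ℝ φ).integral_comp_comm hint).symm
  rw [heval, ClosedBoundedSet.supportFunction_apply]
  -- Integrating `φ ∘ f ≤ support` over selectors gives the upper bound; near-optimal selectors give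
  -- leastness.
  refine IsLUB.unique (s := (φ : StrongDual ℝ E) '' (C : Set E)) ?_ (C.isLUB_support φ)
  rw [← hC, setExpectation, isLUB_image_closure]
  constructor
  · rintro _ ⟨_, ⟨f, hf, rfl⟩, rfl⟩
    have hfi := integrable_of_mem_measurableSelectors hF hf
    simp only
    rw [← (φ : StrongDual ℝ E).integral_comp_comm hfi]
    exact integral_mono ((φ : StrongDual ℝ E).integrable_comp hfi) hintφ
      fun ω => (F ω).apply_le_support φ (hf.2 ω)
  · intro b hb
    refine le_of_forall_pos_le_add fun ε hε => ?_
    obtain ⟨f, hf, hfε⟩ := exists_measurableSelector_support_sub_le hF.stronglyMeasurable hφ hε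
    have hfi := integrable_of_mem_measurableSelectors hF hf
    have h1 : (φ : StrongDual ℝ E) (∫ ω, f ω ∂μ) ≤ b := hb ⟨_, ⟨f, hf, rfl⟩, rfl⟩
    rw [← (φ : StrongDual ℝ E).integral_comp_comm hfi] at h1
    have h2 := integral_mono_ae (hintφ.sub (integrable_const ε))
      ((φ : StrongDual ℝ E).integrable_comp hfi) hfε
    rw [integral_sub' hintφ (integrable_const ε)] at h2
    simp at h2
    linarith

end Selectors

/-! ### Averages of sets and the strong law. -/

theorem Convex.finset_sum {E ι : Type*} [AddCommGroup E] [Module ℝ E] (s : Finset ι)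
    {A : ι → Set E} (h : ∀ i ∈ s, Convex ℝ (A i)) : Convex ℝ (∑ i ∈ s, A i) :=
  Finset.sum_induction A (Convex ℝ) (fun _ _ => Convex.add) convex_zero h

/-- The Hausdorff distance from a mean of closed convex hulls to a convex set is at most the
distance of the corresponding support functions. -/
theorem hausdorffDist_average_closedConvexHull_le {E : Type*} [NormedAddCommGroup E]
    [NormedSpace ℝ E] (A : ℕ → ClosedBoundedSet E) (C : ClosedBoundedSet E)
    (hC : Convex ℝ (C : Set E)) {n : ℕ} (hn : 0 < n) :
    Metric.hausdorffDist
        ((n : ℝ)⁻¹ • closure (∑ i ∈ Finset.range n, closedConvexHull ℝ (A i : Set E))) (C : Set E) ≤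
      dist ((n : ℝ)⁻¹ • ∑ i ∈ Finset.range n, (A i).supportFunction) C.supportFunction := by
  set D : Set E := (n : ℝ)⁻¹ • closure (∑ i ∈ Finset.range n, closedConvexHull ℝ (A i : Set E))
    with hD
  set r := dist ((n : ℝ)⁻¹ • ∑ i ∈ Finset.range n, (A i).supportFunction) C.supportFunction
    with hr
  have hr0 : 0 ≤ r := dist_nonneg
  have hDconv : Convex ℝ D :=
    (Convex.finset_sum _ fun i _ => convex_closedConvexHull).closure.smul _
  have hDlub : ∀ φ : StrongDual ℝ E, ‖φ‖ ≤ 1 →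
      IsLUB (φ '' D) ((n : ℝ)⁻¹ • ∑ i ∈ Finset.range n, (A i).support φ) := fun φ _ =>
    isLUB_image_smul (by positivity) <| isLUB_image_closure.2 <| isLUB_image_sum _ fun i _ =>
      isLUB_image_closedConvexHull.2 ((A i).isLUB_support φ)
  -- In `ℝ` the empty set has no least upper bound, so `hDlub` already forces nonemptiness.
  have hDne : D.Nonempty := by
    by_contra h
    have := (hDlub 0 (by simp)).nonempty
    simp_all [Set.not_nonempty_iff_eq_empty]
  have hclose : ∀ φ : StrongDual ℝ E, ‖φ‖ ≤ 1 →
      |(n : ℝ)⁻¹ • ∑ i ∈ Finset.range n, (A i).support φ - C.support φ| ≤ r := by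
    intro φ hφ
    have := BoundedContinuousFunction.dist_coe_le_dist
      (f := (n : ℝ)⁻¹ • ∑ i ∈ Finset.range n, (A i).supportFunction) (g := C.supportFunction)
      ⟨φ, mem_closedBall_zero_iff.2 hφ⟩
    simpa [Real.dist_eq] using this
  -- Each inclusion separates a point from the other set, so convexity is needed of both `C` and
  -- `D`.
  refine Metric.hausdorffDist_le_of_infDist hr0 (fun x hx => ?_) fun x hx => ?_
  · exact infDist_le_of_support_le hC C.nonempty' hr0 hDlub (fun φ _ => C.isLUB_support φ)
      (fun φ hφ => by linarith [(abs_le.1 (hclose φ hφ)).2]) hx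
  · exact infDist_le_of_support_le hDconv hDne hr0 (fun φ _ => C.isLUB_support φ) hDlub
      (fun φ hφ => by linarith [(abs_le.1 (hclose φ hφ)).1]) hx

theorem theorem6p1 {E : Type*} [NormedAddCommGroup E] [NormedSpace ℝ E] [CompleteSpace E]
    {Ω : Type*} [MeasurableSpace Ω] (μ : Measure Ω) [IsProbabilityMeasure μ] [μ.IsComplete]
    (hμ : HasNoAtoms μ)
    (U : Set (ClosedBoundedSet E)) (hUne : U.Nonempty) (hUsep : TopologicalSpace.IsSeparable U)
    (X : ℕ → Ω → ClosedBoundedSet E) (hXU : ∀ n ω, X n ω ∈ U)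
    (hX : ∀ n, IsRandomSet μ (X n))
    (hindep : iIndepFun X μ) (hident : ∀ n, IdentDistrib (X n) (X 0) μ μ)
    (C : ClosedBoundedSet E) (hC : Convex ℝ (C : Set E))
    (hE : ∀ n, setExpectation μ (X n) = (C : Set E)) :
    ∀ᵐ ω ∂μ, Tendsto
      (fun n : ℕ => Metric.hausdorffDist
        ((n : ℝ)⁻¹ • closure (∑ i ∈ Finset.range n, closedConvexHull ℝ (X i ω : Set E)))
        (C : Set E))
      atTop (𝓝 0) := by
  borelize (BoundedContinuousFunction (Metric.closedBall (0 : StrongDual ℝ E) 1) ℝ)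
  have hmeas : Measurable (ClosedBoundedSet.supportFunction : ClosedBoundedSet E → _) :=
    ClosedBoundedSet.lipschitzWith_supportFunction.continuous.measurable
  -- Banach-valued strong law; the function space need not be separable, since Bochner integrability
  -- suffices.
  have hlaw := strong_law_ae (fun n ω => (X n ω).supportFunction)
    (integrable_supportFunction (hX 0))
    (fun i j hij => (hindep.indepFun hij).comp hmeas hmeas)
    (fun n => (hident n).comp hmeas)
  filter_upwards [hlaw] with ω hω
  rw [integral_supportFunction_eq (hX 0) (hE 0)] at hω
  refine squeeze_zero' (.of_forall fun _ => Metric.hausdorffDist_nonneg) ?_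
    (tendsto_iff_dist_tendsto_zero.1 hω)
  -- Scaling by `n⁻¹` must be by a positive factor, so `n = 0` is dropped.
  filter_upwards [eventually_gt_atTop 0] with n hn
  exact hausdorffDist_average_closedConvexHull_le (fun i => X i ω) C hC hn
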